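/- Theorem. Let $\mathbf{X}$ be a represented space whose representation is admissible and whose topology (the final topology induced by the representation) is Fréchet–Urysohn, that is, the closure of any subset $S$ is the set of all limits of sequences in $S$. Let $\mathrm{VC}_{\mathbf{X}} : \subseteq \mathcal{V}(\mathbf{X}) \rightrightarrows \mathbf{X}$ be overt choice on $\mathbf{X}$: given a non-empty closed set $A \subseteq \mathbf{X}$ by a name of $\{U \in \mathcal{O}(\mathbf{X}) \mid U \cap A \neq \emptyset\}$ as an element of $\mathcal{O}(\mathcal{O}(\mathbf{X}))$, find a point of $A$. Then, for every $m \geq 2$, $\mathrm{ACC}_m$ is not Weihrauch reducible to $\mathrm{VC}_{\mathbf{X}}$, where $\mathrm{ACC}_m$ is the problem: given a set $A \in \{M\} \cup \{M \setminus \{i\} \mid i \in M\}$, $M = \{0, \dots, m-1\}$, as an element of the space $\mathcal{A}(M)$ of closed sets (i.e. by negative information), find an element of $A$. In particular, $\mathrm{LLPO}$ is not Weihrauch reducible to $\mathrm{VC}_{\mathbf{X}}$, where $\mathrm{LLPO}$ is the problem: given $p \in \mathbb{N}^{\mathbb{N}}$ with at most one $k$ such that $p(k) \neq 0$, find $j \in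 \{0,1\}$ such that $p(2n+j) = 0$ for all $n \in \mathbb{N}$. -/

import Mathlib

universe u v w z

/-! ### Partial functions on Baire space -/

/-- Baire space `ℕ^ℕ`; it carries the product of the discrete topologies. -/
abbrev Baire : Type := ℕ → ℕ

namespace Baire

/-- The prefix of `p` of length `k`. -/
def pre (p : Baire) (k : ℕ) : List ℕ := (List.range k).map p

/-- The pairing `⟨p, q⟩ = p(0) q(0) p(1) q(1) …`. -/
def pair (p q : Baire) : Baire := fun n => if n % 2 = 0 then p (n / 2) else q (n / 2)

/-- The code of the question "which value has the output at position `n`, if the input starts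
with the word `σ`?" -/
def code (n : ℕ) (σ : List ℕ) : ℕ := Encodable.encode ((n, σ) : ℕ × List ℕ)

/-- The universal partial function on Baire space, `eval c = Φ_c : ⊆ ℕ^ℕ → ℕ^ℕ` (Kleene's
application of an associate `c`). To find the output at position `n` on input `p`, feed longer
and longer prefixes of `p` to `c`. The answer `0` means "more input is needed", and the first
answer different from `0`, say `m + 1`, means that the output at `n` is `m`. -/
def eval (c : Baire) : Baire →. Baire := fun p =>
  ⟨∀ n, ∃ k, c (code n (p.pre k)) ≠ 0,
   fun h n => c (code n (p.pre (Nat.find (h n)))) - 1⟩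

/-- A partial function on Baire space is computable if it has a computable program `c`, that is,
if its value at each point of its domain is the one that `eval c` computes. -/
def IsComputable (F : Baire →. Baire) : Prop :=
  ∃ c : Baire, Computable c ∧ ∀ p q, q ∈ F p → q ∈ eval c p

theorem pre_getD (p : Baire) {k i : ℕ} (h : i < k) : (p.pre k).getD i 0 = p i := by
  simp [pre, h]

theorem pre_length (p : Baire) (k : ℕ) : (p.pre k).length = k := by
  simp [pre]

theorem pre_take (p : Baire) {j k : ℕ} (h : j ≤ k) : (p.pre k).take j = p.pre j := by
  simp [pre, ← List.map_take, List.take_range, h]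

/-- A total function whose output at `n` depends on the first `b n` inputs only has a program. -/
theorem exists_program (F : Baire → Baire) (b : ℕ → ℕ)
    (hF : ∀ p p' : Baire, ∀ n, (∀ i < b n, p i = p' i) → F p n = F p' n) :
    ∃ c, ∀ p, F p ∈ eval c p := by
  refine ⟨fun a => match (Encodable.decode a : Option (ℕ × List ℕ)) with
    | none => 0
    | some (n, σ) => if σ.length < b n then 0 else F (fun i => σ.getD i 0) n + 1, fun p => ?_⟩
  have key : ∀ n k, (b n ≤ k) → F (fun i => (p.pre k).getD i 0) n = F p n := by
    intro n k hk
    apply hF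
    intro i hi
    exact pre_getD p (lt_of_lt_of_le hi hk)
  rw [eval, Part.mem_mk_iff]
  refine ⟨fun n => ⟨b n, by simp [code, pre_length]⟩, ?_⟩
  funext n
  generalize_proofs h
  have hs := Nat.find_spec h
  revert hs
  generalize Nat.find h = k
  intro hs
  simp only [code, Encodable.encodek, pre_length] at hs ⊢
  have hk : b n ≤ k := by
    by_contra hlt
    exact hs (if_pos (not_le.mp hlt))
  rw [if_neg (not_lt.mpr hk), key n k hk]
  rfl

end Baire

/-! ### Represented spaces -/

/-- A represented space: a set with a partial surjection `δ` from Baire space onto it, given by its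
graph; `names p x` says that `p ∈ dom δ` and `δ p = x`. -/
structure RepSpace where
  carrier : Type u
  names : Baire → carrier → Prop
  functional : ∀ {p x y}, names p x → names p y → x = y
  surjective : ∀ x, ∃ p, names p x

namespace RepSpace

instance : CoeSort RepSpace.{u} (Type u) := ⟨RepSpace.carrier⟩

/-- The domain of the representation. -/
def dom (X : RepSpace.{u}) : Set Baire := {p | ∃ x, X.names p x}

/-- The representation as a function on its domain. -/
noncomputable def δ (X : RepSpace.{u}) (p : X.dom) : X := p.2.choose

theorem names_δ (X : RepSpace.{u}) (p : X.dom) : X.names p (X.δ p) := p.2.choose_spec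

/-- The topology of a represented space: the final topology along the representation, whose
domain carries the subspace topology. -/
noncomputable instance topology (X : RepSpace.{u}) : TopologicalSpace X :=
  TopologicalSpace.coinduced X.δ inferInstance

/-- The representation is admissible: every topologically continuous partial function `φ` from
Baire space to `X` factors through `δ` by a continuous partial function on Baire space with the
same domain. (Continuity of `δ` is automatic for the final topology.) -/
def Admissible (X : RepSpace.{u}) : Prop :=
  ∀ (D : Set Baire) (φ : D → X), Continuous φ →
    ∃ F : D → Baire, Continuous F ∧ ∀ p, X.names (F p) (φ p)

/-- `p` is a name of the total function `f : X → Y`: the partial function `eval p` realizes `f`. -/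
def Tracks {X : RepSpace.{u}} {Y : RepSpace.{v}} (p : Baire) (f : X → Y) : Prop :=
  ∀ q x, X.names q x → ∃ r ∈ Baire.eval p q, Y.names r (f x)

/-- The space `C(X, Y)` of (realizably) continuous functions. -/
def funSpace (X : RepSpace.{u}) (Y : RepSpace.{v}) : RepSpace.{max u v} where
  carrier := {f : X → Y // ∃ p, Tracks p f}
  names p f := Tracks p f.1
  functional := by
    rintro p ⟨f, _⟩ ⟨g, _⟩ hf hg
    refine Subtype.ext (funext fun x => ?_)
    obtain ⟨q, hq⟩ := X.surjective x
    obtain ⟨r, hr, hrf⟩ := hf q x hq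
    obtain ⟨r', hr', hrg⟩ := hg q x hq
    rw [Part.mem_unique hr' hr] at hrg
    exact Y.functional hrf hrg
  surjective f := f.2

/-- Sierpiński space with the points `⊤ = True` and `⊥ = False`; the only name of `⊥` is
the sequence that is constantly zero. -/
def sierpinski : RepSpace.{0} where
  carrier := Prop
  names p b := b ↔ ∃ n, p n ≠ 0
  functional h h' := propext (h.trans h'.symm)
  surjective b := by
    by_cases h : b
    · exact ⟨fun _ => 1, by simp [h]⟩
    · exact ⟨fun _ => 0, by simp [h]⟩

/-- The space `O(X)` of open subsets of `X`: an open set is identified with its characteristic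
function `X → Prop`, a point of `C(X, Σ)`. -/
def openSpace (X : RepSpace.{u}) : RepSpace.{u} := funSpace X sierpinski

/-- `p` is a name of the set `S` as a point of `O(X)`. -/
def TracksSet {X : RepSpace.{u}} (p : Baire) (S : Set X) : Prop :=
  Tracks (X := X) (Y := sierpinski) p fun x => x ∈ S

/-- The points `U` of `O(X)`, as sets, that intersect `A`. -/
def hit {X : RepSpace.{u}} (A : Set X) : Set X.openSpace :=
  {U | ∃ x ∈ A, U.1 x}

/-- Every set that is open in the final topology is a point of `O(X)`. -/
theorem exists_tracksSet_of_isOpen {X : RepSpace.{u}} {U : Set X} (hU : IsOpen U) :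
    ∃ p, TracksSet p U := by
  classical
  rw [isOpen_coinduced, isOpen_induced_iff] at hU
  obtain ⟨V, hV, hVU⟩ := hU
  have hmem : ∀ q x, X.names q x → (x ∈ U ↔ q ∈ V) := by
    intro q x hq
    have h1 := Set.ext_iff.mp hVU ⟨q, x, hq⟩
    have h2 : X.δ ⟨q, x, hq⟩ = x := X.functional (X.names_δ _) hq
    simp only [Set.mem_preimage, h2] at h1
    exact h1.symm
  obtain ⟨c, hc⟩ := Baire.exists_program
    (fun q n => if (∀ q' : Baire, (∀ i < n, q' i = q i) → q' ∈ V) then 1 else 0) id (by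
      intro p p' n h
      have : (∀ q' : Baire, (∀ i < n, q' i = p i) → q' ∈ V) ↔
          (∀ q' : Baire, (∀ i < n, q' i = p' i) → q' ∈ V) := by
        constructor <;> intro H q' hq' <;> apply H <;> intro i hi
        · rw [hq' i hi, h i hi]
        · rw [hq' i hi, ← h i hi]
      simp only [this])
  refine ⟨c, fun q x hq => ⟨_, hc q, ?_⟩⟩
  change x ∈ U ↔ ∃ n, _ ≠ 0
  rw [hmem q x hq]
  constructor
  · intro hqV
    obtain ⟨n, hn⟩ := (PiNat.isOpen_iff_dist (E := fun _ => ℕ) V).mp hV q hqV |> fun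
      | ⟨ε, hε, h⟩ => show ∃ n, ∀ q' : Baire, (∀ i < n, q' i = q i) → q' ∈ V from by
        obtain ⟨n, hn⟩ := exists_pow_lt_of_lt_one hε (by norm_num : (1 / 2 : ℝ) < 1)
        exact ⟨n, fun q' hq' => h q' (lt_of_le_of_lt
          (PiNat.mem_cylinder_iff_dist_le.mp fun i hi => (hq' i hi).symm) hn)⟩
    exact ⟨n, by simpa using hn⟩
  · rintro ⟨n, hn⟩
    by_contra hq
    exact hn (if_neg fun H => hq (H q fun _ _ => rfl))

/-- For every set `A`, the set of all open sets that intersect `A` is a point of `O(O(X))`. -/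
theorem exists_tracksSet_hit {X : RepSpace.{u}} (A : Set X) : ∃ p, TracksSet p (hit A) := by
  classical
  let E : List ℕ → Prop := fun σ => ∃ q x k, X.names q x ∧ x ∈ A ∧ σ = q.pre k
  let W : Baire → ℕ → List ℕ → Prop := fun p n σ =>
    2 ≤ p (Baire.code n σ) ∧ ∀ j < σ.length, p (Baire.code n (σ.take j)) = 0
  let B : ℕ → List ℕ → ℕ := fun n σ =>
    Baire.code n σ + 1 + ∑ j ∈ Finset.range σ.length, (Baire.code n (σ.take j) + 1)
  have hW : ∀ p p' : Baire, ∀ n σ, (∀ i < B n σ, p i = p' i) → W p n σ → W p' n σ := by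
    rintro p p' n σ h ⟨h1, h2⟩
    refine ⟨?_, fun j hj => ?_⟩
    · rw [← h _ (by simp only [B]; omega)]
      exact h1
    · have := Finset.single_le_sum (f := fun j => Baire.code n (σ.take j) + 1)
        (fun _ _ => Nat.zero_le _) (Finset.mem_range.mpr hj)
      rw [← h _ (by simp only [B]; omega)]
      exact h2 j hj
  let F : Baire → Baire := fun p N =>
    match (Encodable.decode N : Option (ℕ × List ℕ)) with
    | none => 0
    | some (n, σ) => if E σ ∧ W p n σ then 1 else 0
  let b : ℕ → ℕ := fun N =>
    match (Encodable.decode N : Option (ℕ × List ℕ)) with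
    | none => 0
    | some (n, σ) => B n σ
  obtain ⟨c, hc⟩ := Baire.exists_program F b (by
    intro p p' N h
    simp only [F, b] at h ⊢
    cases hd : (Encodable.decode N : Option (ℕ × List ℕ)) with
    | none => rfl
    | some a =>
      obtain ⟨n, σ⟩ := a
      simp only [hd] at h ⊢
      have : W p n σ ↔ W p' n σ :=
        ⟨hW p p' n σ h, hW p' p n σ fun i hi => (h i hi).symm⟩
      simp only [this])
  refine ⟨c, fun p U hp => ⟨_, hc p, ?_⟩⟩
  have hp' : ∀ q x, X.names q x → ∃ r ∈ Baire.eval p q, (U.1 x ↔ ∃ n, r n ≠ 0) := hp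
  change (∃ x ∈ A, U.1 x) ↔ ∃ N, F p N ≠ 0
  constructor
  · rintro ⟨x, hxA, hxU⟩
    obtain ⟨q, hq⟩ := X.surjective x
    obtain ⟨r, ⟨hr, rfl⟩, h⟩ := hp' q x hq
    obtain ⟨n, hn⟩ := h.mp hxU
    refine ⟨Baire.code n (q.pre (Nat.find (hr n))), ?_⟩
    have hw : W p n (q.pre (Nat.find (hr n))) := by
      refine ⟨?_, fun j hj => ?_⟩
      · have hn' : p (Baire.code n (q.pre (Nat.find (hr n)))) - 1 ≠ 0 := hn
        omega
      · rw [Baire.pre_length] at hj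
        rw [Baire.pre_take q hj.le]
        exact not_not.mp (Nat.find_min (hr n) hj)
    have he : E (q.pre (Nat.find (hr n))) := ⟨q, x, _, hq, hxA, rfl⟩
    have : F p (Baire.code n (q.pre (Nat.find (hr n)))) = 1 := by
      simp only [F, Baire.code, Encodable.encodek]
      exact if_pos ⟨he, hw⟩
    rw [this]
    exact one_ne_zero
  · rintro ⟨N, hN⟩
    simp only [F] at hN
    cases hd : (Encodable.decode N : Option (ℕ × List ℕ)) with
    | none =>
      simp only [hd] at hN
      exact absurd rfl hN
    | some a =>
      obtain ⟨n, σ⟩ := a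
      simp only [hd] at hN
      have hEW : E σ ∧ W p n σ := by
        by_contra hne
        exact hN (if_neg hne)
      obtain ⟨⟨q, x, k, hq, hxA, rfl⟩, hw1, hw2⟩ := hEW
      refine ⟨x, hxA, ?_⟩
      obtain ⟨r, ⟨hr, rfl⟩, h⟩ := hp' q x hq
      refine h.mpr ⟨n, ?_⟩
      have hk : Nat.find (hr n) = k := by
        rw [Nat.find_eq_iff]
        refine ⟨by omega, fun j hj => ?_⟩
        have := hw2 j (by rwa [Baire.pre_length])
        rw [Baire.pre_take q hj.le] at this
        exact not_not.mpr this
      change p (Baire.code n (q.pre (Nat.find (hr n)))) - 1 ≠ 0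
      rw [hk]
      omega

/-- The space `A(X)` of closed subsets: `p` is a name of `A` if it is a name of the complement
of `A` in `O(X)`. -/
def negSpace (X : RepSpace.{u}) : RepSpace.{u} where
  carrier := TopologicalSpace.Closeds X
  names p A := TracksSet p (A : Set X)ᶜ
  functional := by
    intro p A B hA hB
    have h := (funSpace X sierpinski).functional
      (x := ⟨fun x => x ∈ (A : Set X)ᶜ, p, hA⟩) (y := ⟨fun x => x ∈ (B : Set X)ᶜ, p, hB⟩) hA hB
    have h2 : (A : Set X)ᶜ = (B : Set X)ᶜ := congrArg Subtype.val h
    exact SetLike.coe_injective (compl_injective h2)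
  surjective A := exists_tracksSet_of_isOpen A.isClosed.isOpen_compl

/-- The space `V(X)` of (closed) overt subsets: `p` is a name of `A` if it is a name of the set
of all open sets that intersect `A` in `O(O(X))`. -/
def overtSpace (X : RepSpace.{u}) : RepSpace.{u} where
  carrier := TopologicalSpace.Closeds X
  names p A := TracksSet p (hit (A : Set X))
  functional := by
    have key : ∀ (p : Baire) (A B : TopologicalSpace.Closeds X),
        TracksSet p (hit (A : Set X)) → TracksSet p (hit (B : Set X)) →
          (B : Set X) ⊆ (A : Set X) := by
      intro p A B hA hB x hx
      by_contra hxA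
      have h := (funSpace X.openSpace sierpinski).functional
        (x := ⟨fun U => U ∈ hit (A : Set X), p, hA⟩)
        (y := ⟨fun U => U ∈ hit (B : Set X), p, hB⟩) hA hB
      have h2 : hit (A : Set X) = hit (B : Set X) := congrArg Subtype.val h
      let U : X.openSpace :=
        ⟨fun y => y ∈ (A : Set X)ᶜ, exists_tracksSet_of_isOpen A.isClosed.isOpen_compl⟩
      have hU : U ∈ hit (B : Set X) := ⟨x, hx, hxA⟩
      rw [← h2] at hU
      obtain ⟨y, hyA, hy⟩ := hU
      exact hy hyA
    intro p A B hA hB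
    exact SetLike.coe_injective (Set.Subset.antisymm (key p B A hB hA) (key p A B hA hB))
  surjective A := exists_tracksSet_hit (A : Set X)

/-- Baire space, represented by the identity. -/
def baireSpace : RepSpace.{0} where
  carrier := Baire
  names p x := p = x
  functional h h' := h.symm.trans h'
  surjective x := ⟨x, rfl⟩

/-- The finite discrete space `{0, …, m - 1}`; the names of `i` are the sequences that start
with `i`. -/
def finSpace (m : ℕ) : RepSpace.{0} where
  carrier := Fin m
  names p i := p 0 = (i : ℕ)
  functional h h' := Fin.ext (h.symm.trans h')
  surjective i := ⟨fun _ => i, rfl⟩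

end RepSpace

open RepSpace

/-! ### Problems and Weihrauch reducibility -/

/-- A partial multivalued function `X ⇉ Y`. Its domain is the set of all `x` for which the set
`f x` of admissible values is non-empty. -/
abbrev Problem (X : RepSpace.{u}) (Y : RepSpace.{v}) : Type (max u v) := X → Set Y

/-- `F` is a realizer of `f`: it maps each name of a point `x` in the domain of `f` to a name of
some point in `f x`. -/
def Realizes {X : RepSpace.{u}} {Y : RepSpace.{v}} (F : Baire →. Baire) (f : Problem X Y) : Prop :=
  ∀ p x, X.names p x → (f x).Nonempty → ∃ q ∈ F p, ∃ y ∈ f x, Y.names q y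

/-- The partial function `K(⟨id, G H⟩)` on Baire space. -/
def sandwich (K G H : Baire →. Baire) : Baire →. Baire := fun p =>
  (H p).bind fun r => (G r).bind fun s => K (Baire.pair p s)

/-- Weihrauch reducibility `f ≤_W g`. -/
def WeihrauchLE {X : RepSpace.{u}} {Y : RepSpace.{v}} {Z : RepSpace.{w}} {W : RepSpace.{z}}
    (f : Problem X Y) (g : Problem Z W) : Prop :=
  ∃ H K : Baire →. Baire, Baire.IsComputable H ∧ Baire.IsComputable K ∧
    ∀ G : Baire →. Baire, Realizes G g → Realizes (sandwich K G H) f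

/-- Overt choice on `X`: given a non-empty `A ∈ V(X)`, find a point of `A`. -/
def VC (X : RepSpace.{u}) : Problem X.overtSpace X := fun A : TopologicalSpace.Closeds X =>
  (A : Set X)

/-- All-or-co-unique choice on `M = {0, …, m - 1}`: given `A ∈ A(M)` which is `M` or `M ∖ {i}` for
some `i`, find a point of `A`. -/
def ACC (m : ℕ) : Problem (finSpace m).negSpace (finSpace m) :=
  fun A : TopologicalSpace.Closeds (finSpace m) =>
    {x | x ∈ A ∧ ((A : Set (finSpace m)) = Set.univ ∨ ∃ i, (A : Set (finSpace m)) = {i}ᶜ)}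

/-- The lesser limited principle of omniscience: given `p` with at most one non-zero entry, find
`j ∈ {0, 1}` such that `p(2n + j) = 0` for all `n`. -/
def LLPO : Problem baireSpace (finSpace 2) := fun p : Baire =>
  {j : Fin 2 | (∀ k l, p k ≠ 0 → p l ≠ 0 → k = l) ∧ ∀ n, p (2 * n + (j : ℕ)) = 0}

/-! The obstruction is topological: computable functions on Baire space are sequentially continuous.
Suppose that an instance with name `p'` is, for every answer `i`, a limit of instances `z i k` for
which `i` is wrong. A reduction turns these into overt sets `A'` and `A i k`, and convergence of
their names makes every open set that meets `A'` meet `A i k` for large `k`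
(`eventually_hit_of_tendsto`). Fix `x` in `A'`. The Fréchet–Urysohn property gives, for each `i`,
points of the sets `A i k`, with indices tending to infinity, that converge to `x`. Admissibility
lifts convergence to names (`Admissible.exists_names_tendsto`), so by continuity the answer `i`
computed at `x` is also given on instances `z i k`, where it is wrong. This is `not_weihrauchLE_VC`;
`ACC` and `LLPO` only need suitable instances. -/

namespace Baire

/-! ### Sequential continuity on Baire space -/

theorem tendsto_iff_forall_eventually_eq {u : ℕ → Baire} {p : Baire} :
    Filter.Tendsto u Filter.atTop (nhds p) ↔ ∀ n, ∀ᶠ k in Filter.atTop, u k n = p n := by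
  rw [tendsto_pi_nhds]
  simp [nhds_discrete, Filter.tendsto_pure]

theorem eventually_apply_eq (p : Baire) (i : ℕ) : ∀ᶠ q in nhds p, q i = p i :=
  (continuous_apply (A := fun _ : ℕ => ℕ) i).continuousAt.eventually
    (Filter.eventually_of_mem ((isOpen_discrete {p i}).mem_nhds rfl) fun _ h => h)

theorem pre_congr {p q : Baire} {k : ℕ} (h : ∀ i < k, p i = q i) : p.pre k = q.pre k :=
  List.map_congr_left fun i hi => h i (List.mem_range.mp hi)

/-- The output position `n` of `eval c p` is determined by finitely many positions of both the
program `c` and the input `p`. -/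
theorem eval_tendsto {c p q : ℕ → Baire} {c' p' q' : Baire}
    (hc : Filter.Tendsto c Filter.atTop (nhds c')) (hp : Filter.Tendsto p Filter.atTop (nhds p'))
    (hq' : q' ∈ eval c' p') (hq : ∀ k, q k ∈ eval (c k) (p k)) :
    Filter.Tendsto q Filter.atTop (nhds q') := by
  rw [tendsto_iff_forall_eventually_eq] at hc hp ⊢
  intro n
  obtain ⟨h', rfl⟩ := hq'
  set N := Nat.find (h' n) with hN
  have hpre : ∀ᶠ k in Filter.atTop, ∀ i < N, p k i = p' i :=
    (Filter.eventually_all_finite (Set.finite_Iio N)).2 fun i _ => hp i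
  have hcode : ∀ᶠ k in Filter.atTop, ∀ j ≤ N, c k (code n (p'.pre j)) = c' (code n (p'.pre j)) :=
    (Filter.eventually_all_finite (Set.finite_Iic N)).2 fun j _ => hc _
  filter_upwards [hpre, hcode] with k hk hk'
  obtain ⟨h, hqk⟩ := hq k
  have hsame : ∀ j ≤ N, c k (code n ((p k).pre j)) = c' (code n (p'.pre j)) := by
    intro j hj
    rw [pre_congr fun i hi => hk i (hi.trans_le hj), hk' j hj]
  have hfind : Nat.find (h n) = N := by
    rw [Nat.find_eq_iff]
    refine ⟨by rw [hsame N le_rfl]; exact Nat.find_spec (h' n), fun j hj => ?_⟩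
    rw [hsame j hj.le]
    exact Nat.find_min (h' n) hj
  rw [← hqk]
  change c k (code n ((p k).pre (Nat.find (h n)))) - 1 = c' (code n (p'.pre N)) - 1
  rw [hfind, hsame N le_rfl]

theorem IsComputable.tendsto {F : Baire →. Baire} (hF : IsComputable F) {p q : ℕ → Baire}
    {p' q' : Baire} (hp : Filter.Tendsto p Filter.atTop (nhds p')) (hq' : q' ∈ F p')
    (hq : ∀ k, q k ∈ F (p k)) : Filter.Tendsto q Filter.atTop (nhds q') := by
  obtain ⟨c, -, hc⟩ := hF
  exact eval_tendsto tendsto_const_nhds hp (hc _ _ hq') fun k => hc _ _ (hq k)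

theorem tendsto_pair {p q : ℕ → Baire} {p' q' : Baire}
    (hp : Filter.Tendsto p Filter.atTop (nhds p'))
    (hq : Filter.Tendsto q Filter.atTop (nhds q')) :
    Filter.Tendsto (fun k => pair (p k) (q k)) Filter.atTop (nhds (pair p' q')) := by
  rw [tendsto_iff_forall_eventually_eq] at hp hq ⊢
  intro n
  filter_upwards [hp (n / 2), hq (n / 2)] with k h h'
  simp [pair, h, h']

end Baire

/-! ### Convergence of points, of overt sets and of their names -/

namespace RepSpace

/-- In an admissibly represented space, convergent sequences lift to convergent sequences
of names. -/
theorem Admissible.exists_names_tendsto {X : RepSpace.{u}} (hX : X.Admissible) {y : ℕ → X} {x : X}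
    (hy : Filter.Tendsto y Filter.atTop (nhds x)) :
    ∃ (s : ℕ → Baire) (s' : Baire), (∀ n, X.names (s n) (y n)) ∧ X.names s' x ∧
      Filter.Tendsto s Filter.atTop (nhds s') := by
  classical
  -- The spikes together with their limit `0` form a copy of `ℕ ∪ {∞}` in Baire space. Reading off
  -- the first nonzero position extends the convergent sequence to a continuous map on all of Baire
  -- space, to which admissibility applies.
  let spike : ℕ → Baire := fun n => Pi.single n 1
  let φ : Baire → X := fun p => if h : ∃ n, p n ≠ 0 then y (Nat.find h) else x
  have hspike : ∀ n, φ (spike n) = y n := by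
    intro n
    have h : ∃ k, spike n k ≠ 0 := ⟨n, by simp [spike]⟩
    have hn : Nat.find h = n := by
      rw [Nat.find_eq_iff]
      exact ⟨by simp [spike], fun j hj => by simp [spike, hj.ne]⟩
    simp only [φ, dif_pos h, hn]
  have hzero : φ 0 = x := dif_neg (by simp)
  have hφ : Continuous φ := by
    rw [continuous_iff_continuousAt]
    intro p
    by_cases h : ∃ n, p n ≠ 0
    · have hev : ∀ᶠ q in nhds p, ∀ i ≤ Nat.find h, q i = p i := by
        refine (Filter.eventually_all_finite (Set.finite_Iic _)).2 fun i _ => ?_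
        exact Baire.eventually_apply_eq p i
      refine Filter.Tendsto.congr' (f₁ := fun _ => φ p) ?_ tendsto_const_nhds
      filter_upwards [hev] with q hq
      have h' : ∃ n, q n ≠ 0 := ⟨_, by rw [hq _ le_rfl]; exact Nat.find_spec h⟩
      have hfind : Nat.find h' = Nat.find h := by
        rw [Nat.find_eq_iff]
        refine ⟨by rw [hq _ le_rfl]; exact Nat.find_spec h, fun j hj => ?_⟩
        rw [hq j hj.le]
        exact Nat.find_min h hj
      simp only [φ, dif_pos h, dif_pos h', hfind]
    · have hp : p = 0 := by
        push Not at h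
        exact funext h
      subst hp
      rw [ContinuousAt, hzero]
      intro U hU
      obtain ⟨N, hN⟩ := Filter.eventually_atTop.mp (hy hU)
      have hev : ∀ᶠ q : Baire in nhds 0, ∀ i < N, q i = 0 := by
        refine (Filter.eventually_all_finite (Set.finite_Iio _)).2 fun i _ => ?_
        exact Baire.eventually_apply_eq 0 i
      refine hev.mono fun q hq => ?_
      by_cases h' : ∃ n, q n ≠ 0
      · simp only [φ, dif_pos h']
        exact hN _ (not_lt.mp fun hlt => Nat.find_spec h' (hq _ hlt))
      · simp only [φ, dif_neg h']
        exact mem_of_mem_nhds hU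
  obtain ⟨F, hF, hnames⟩ := hX Set.univ (fun p => φ p) (hφ.comp continuous_subtype_val)
  refine ⟨fun n => F ⟨spike n, trivial⟩, F ⟨0, trivial⟩, fun n => ?_, ?_, ?_⟩
  · simpa [hspike] using hnames ⟨spike n, trivial⟩
  · simpa [hzero] using hnames ⟨0, trivial⟩
  · refine (hF.tendsto _).comp (tendsto_subtype_rng.2 ?_)
    rw [Baire.tendsto_iff_forall_eventually_eq]
    intro n
    filter_upwards [Filter.eventually_gt_atTop n] with k hk
    simp [spike, hk.ne]

/-- Convergence of names in `V(X)` implies convergence in the lower Vietoris topology. -/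
theorem eventually_hit_of_tendsto {X : RepSpace.{u}} {r : ℕ → Baire} {r' : Baire}
    {A : ℕ → Set X} {A' : Set X} (hr : ∀ k, TracksSet (r k) (hit (A k)))
    (hr' : TracksSet r' (hit A')) (hlim : Filter.Tendsto r Filter.atTop (nhds r'))
    {U : Set X} (hU : IsOpen U) (hUA : (U ∩ A').Nonempty) :
    ∀ᶠ k in Filter.atTop, (U ∩ A k).Nonempty := by
  obtain ⟨u, hu⟩ := exists_tracksSet_of_isOpen hU
  let V : X.openSpace := ⟨fun x => x ∈ U, u, hu⟩
  have hmem : ∀ B : Set X, V ∈ hit B ↔ (U ∩ B).Nonempty := fun B =>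
    ⟨fun ⟨x, hx, hxU⟩ => ⟨x, hxU, hx⟩, fun ⟨x, hxU, hx⟩ => ⟨x, hx, hxU⟩⟩
  obtain ⟨t', ht', hV'⟩ := hr' u V hu
  choose t ht hV using fun k => hr k u V hu
  -- A single nonzero digit certifies the intersection, and it persists along the converging
  -- outputs.
  obtain ⟨n, hn⟩ := hV'.1 ((hmem A').2 hUA)
  have htlim := Baire.tendsto_iff_forall_eventually_eq.1
    (Baire.eval_tendsto hlim tendsto_const_nhds ht' ht) n
  filter_upwards [htlim] with k hk
  exact (hmem _).1 ((hV k).2 ⟨n, hk ▸ hn⟩)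

end RepSpace

/-- In a Fréchet–Urysohn space, a point of the lower limit of a sequence of closed sets is the
limit of points from these sets with indices that tend to infinity. -/
theorem exists_seq_tendsto_of_eventually_inter_nonempty {X : Type*} [TopologicalSpace X]
    [FrechetUrysohnSpace X] {A : ℕ → Set X} (hA : ∀ k, IsClosed (A k)) {x : X}
    (hx : ∀ U, IsOpen U → x ∈ U → ∀ᶠ k in Filter.atTop, (U ∩ A k).Nonempty) :
    ∃ (y : ℕ → X) (k : ℕ → ℕ), (∀ n, y n ∈ A (k n)) ∧
      Filter.Tendsto k Filter.atTop Filter.atTop ∧ Filter.Tendsto y Filter.atTop (nhds x) := by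
  -- If `x` lies in infinitely many of the sets, a constant sequence works. Otherwise, dropping
  -- finitely many sets leaves only closed sets that miss `x`; a sequence tending to `x` leaves each
  -- of them eventually, which forces the indices to infinity.
  by_cases hfreq : ∃ᶠ k in Filter.atTop, x ∈ A k
  · obtain ⟨k, hk, hxk⟩ := Filter.extraction_of_frequently_atTop hfreq
    exact ⟨fun _ => x, k, hxk, hk.tendsto_atTop, tendsto_const_nhds⟩
  rw [Filter.not_frequently] at hfreq
  obtain ⟨N, hN⟩ := Filter.eventually_atTop.mp hfreq
  have hcl : x ∈ closure (⋃ k ≥ N, A k) := by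
    refine mem_closure_iff.2 fun U hU hxU => ?_
    obtain ⟨k, ⟨y, hyU, hyA⟩, hk⟩ := ((hx U hU hxU).and (Filter.eventually_ge_atTop N)).exists
    exact ⟨y, hyU, Set.mem_iUnion₂.2 ⟨k, hk, hyA⟩⟩
  obtain ⟨y, hy, hlim⟩ := mem_closure_iff_seq_limit.1 hcl
  choose k hkN hk using fun n => Set.mem_iUnion₂.1 (hy n)
  refine ⟨y, k, hk, ?_, hlim⟩
  rw [Filter.tendsto_atTop]
  intro M
  have hopen : ∀ j, ∀ᶠ n in Filter.atTop, N ≤ j → y n ∉ A j := by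
    intro j
    by_cases hj : N ≤ j
    · exact (hlim.eventually ((hA j).isOpen_compl.mem_nhds (hN j hj))).mono fun n hn _ => hn
    · exact Filter.Eventually.of_forall fun n h => absurd h hj
  have hall : ∀ᶠ n in Filter.atTop, ∀ j < M, N ≤ j → y n ∉ A j :=
    (Filter.eventually_all_finite (Set.finite_Iio M)).2 fun j _ => hopen j
  filter_upwards [hall] with n hn
  exact not_lt.mp fun hlt => hn _ hlt (hkN n) (hk n)

/-! ### Reductions to overt choice -/

/-- The information provided by a Weihrauch reduction to overt choice. -/
theorem WeihrauchLE.exists_overt {X : RepSpace.{u}} {Z : RepSpace.{v}} {W : RepSpace.{w}}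
    {f : Problem Z W} (h : WeihrauchLE f (VC X)) :
    ∃ H K : Baire →. Baire, Baire.IsComputable H ∧ Baire.IsComputable K ∧
      ∀ p z, Z.names p z → (f z).Nonempty → ∃ r ∈ H p, ∃ A : TopologicalSpace.Closeds X,
        X.overtSpace.names r A ∧ (A : Set X).Nonempty ∧
        ∀ x ∈ A, ∀ s, X.names s x → ∃ q ∈ K (Baire.pair p s), ∃ y ∈ f z, W.names q y := by
  classical
  obtain ⟨H, K, hH, hK, hred⟩ := h
  refine ⟨H, K, hH, hK, fun p z hp hz => ?_⟩
  let IsAnswer : Baire → Baire → Prop := fun r s =>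
    ∃ A : TopologicalSpace.Closeds X, X.overtSpace.names r A ∧ ∃ x ∈ A, X.names s x
  let G : Baire →. Baire := fun r => ⟨∃ s, IsAnswer r s, fun h => h.choose⟩
  have hG : ∀ r s, s ∈ G r → IsAnswer r s := by
    rintro r s ⟨h, rfl⟩
    exact h.choose_spec
  have hGdom : ∀ r (A : TopologicalSpace.Closeds X), X.overtSpace.names r A →
      (A : Set X).Nonempty → ∃ s ∈ G r, ∃ x ∈ A, X.names s x := by
    rintro r A hr ⟨x, hx⟩
    obtain ⟨s, hs⟩ := X.surjective x
    have h : ∃ s, IsAnswer r s := ⟨s, A, hr, x, hx, hs⟩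
    obtain ⟨B, hB, y, hy, hsy⟩ := h.choose_spec
    obtain rfl : A = B := X.overtSpace.functional hr hB
    exact ⟨h.choose, ⟨h, rfl⟩, y, hy, hsy⟩
  -- This first run only shows that `H p` is defined and names a non-empty set.
  obtain ⟨q, hq, -⟩ := hred G hGdom p z hp hz
  obtain ⟨r, hr, hq⟩ := Part.mem_bind_iff.1 hq
  obtain ⟨s₀, hs₀, -⟩ := Part.mem_bind_iff.1 hq
  obtain ⟨A, hA, x₀, hx₀, -⟩ := hG r s₀ hs₀
  refine ⟨r, hr, A, hA, ⟨x₀, hx₀⟩, fun x hx s hs => ?_⟩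
  -- Changing the realizer at the single name `r` lets it return any prescribed name of any point of
  -- `A`.
  let G' : Baire →. Baire := fun t => if t = r then Part.some s else G t
  have hG' : Realizes G' (VC X) := by
    intro t B ht hB
    by_cases htr : t = r
    · subst htr
      obtain rfl : A = B := X.overtSpace.functional hA ht
      exact ⟨s, by simp [G'], x, hx, hs⟩
    · simp only [G', if_neg htr]
      exact hGdom t B ht hB
  obtain ⟨q, hq, hqy⟩ := hred G' hG' p z hp hz
  obtain ⟨r', hr', hq'⟩ := Part.mem_bind_iff.1 hq
  obtain rfl := Part.mem_unique hr hr'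
  obtain ⟨s', hs', hqK⟩ := Part.mem_bind_iff.1 hq'
  obtain rfl : s' = s := by simpa [G'] using hs'
  exact ⟨q, hqK, hqy⟩

/-- A problem with values in `{0, …, m - 1}` is not reducible to overt choice if some instance is,
for every `i`, a limit of instances for which the answer `i` is wrong. -/
theorem not_weihrauchLE_VC {X : RepSpace.{u}} (hadm : X.Admissible) (hFU : FrechetUrysohnSpace X)
    {Z : RepSpace.{v}} {m : ℕ} {f : Problem Z (finSpace m)} {p' : Baire} {z' : Z}
    (hp' : Z.names p' z') (hz' : (f z').Nonempty) {p : Fin m → ℕ → Baire} {z : Fin m → ℕ → Z}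
    (hp : ∀ i k, Z.names (p i k) (z i k)) (hz : ∀ i k, (f (z i k)).Nonempty)
    (hlim : ∀ i, Filter.Tendsto (p i) Filter.atTop (nhds p')) (hf : ∀ i k, i ∉ f (z i k)) :
    ¬ WeihrauchLE f (VC X) := by
  intro hred
  obtain ⟨H, K, hH, hK, h⟩ := hred.exists_overt
  obtain ⟨r', hr', A', hA', ⟨x, hx⟩, hans'⟩ := h p' z' hp' hz'
  choose r hr A hA hne hans using fun i k => h (p i k) (z i k) (hp i k) (hz i k)
  have hm : 0 < m := let ⟨i, _⟩ := hz'; (show Fin m from i).pos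
  choose y k hyA hk hy using fun i => exists_seq_tendsto_of_eventually_inter_nonempty
    (A := fun k => (A i k : Set X)) (fun k => (A i k).isClosed) (x := x) fun U hU hxU =>
      eventually_hit_of_tendsto (hA i) hA' (hH.tendsto (hlim i) hr' (hr i)) hU ⟨x, hxU, hx⟩
  -- The `m` sequences are interleaved by residue so that one lift serves them all. Separate lifts
  -- could tend to different names of `x`, on which `K` may give different answers.
  let idx : ℕ → Fin m := fun n => ⟨n % m, Nat.mod_lt n hm⟩
  have hylim : Filter.Tendsto (fun n => y (idx n) n) Filter.atTop (nhds x) := by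
    intro U hU
    have hall : ∀ᶠ n in Filter.atTop, ∀ i, y i n ∈ U :=
      Filter.eventually_all.2 fun i => hy i hU
    exact hall.mono fun n hn => hn _
  obtain ⟨s, s', hs, hs', hslim⟩ := hadm.exists_names_tendsto hylim
  obtain ⟨q', hq', i, -, hi⟩ := hans' x hx s' hs'
  change Fin m at i
  -- Only now, with `i` being the answer on the limit name, is the subsequence of residue `i`
  -- selected.
  let g : ℕ → ℕ := fun n => m * n + i
  have hg : Filter.Tendsto g Filter.atTop Filter.atTop :=
    Filter.tendsto_atTop_mono (fun n => (Nat.le_mul_of_pos_left n hm).trans (Nat.le_add_right _ _))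
      Filter.tendsto_id
  have hidx : ∀ n, idx (g n) = i := fun n =>
    Fin.ext (by simp [idx, g, Nat.mod_eq_of_lt i.isLt])
  have hsg : ∀ n, X.names (s (g n)) (y i (g n)) := fun n => by
    simpa only [hidx] using hs (g n)
  choose q hq j hj hqj using fun n => hans i (k i (g n)) _ (hyA i (g n)) _ (hsg n)
  have hqlim := hK.tendsto
    (Baire.tendsto_pair ((hlim i).comp ((hk i).comp hg)) (hslim.comp hg)) hq' hq
  -- The digit at position 0 alone decides which point of `finSpace m` is named.
  obtain ⟨n, hn⟩ := (Baire.tendsto_iff_forall_eventually_eq.1 hqlim 0).exists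
  have hji : j n = i := (finSpace m).functional (hqj n) (hn.trans hi)
  exact hf i _ (hji ▸ hj n)

/-! ### Delayed negative information on finite spaces -/

namespace RepSpace

/-- A program of the set `S` in `{0, …, m - 1}` that enumerates the elements after `k` steps. -/
noncomputable def delayedProgram (S : Set ℕ) (k : ℕ) : Baire := by
  classical
  exact fun a => match (Encodable.decode a : Option (ℕ × List ℕ)) with
    | none => 0
    | some (n, σ) => if σ.length = 0 then 0 else if σ.getD 0 0 ∈ S ∧ k ≤ n then 2 else 1

open scoped Classical in
theorem delayedProgram_code (S : Set ℕ) (k n : ℕ) (σ : List ℕ) :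
    delayedProgram S k (Baire.code n σ) =
      if σ.length = 0 then 0 else if σ.getD 0 0 ∈ S ∧ k ≤ n then 2 else 1 := by
  simp only [delayedProgram, Baire.code, Encodable.encodek]

/-- The answer 0 on the empty word forces `q 0` to be read. After that, answers 2 and 1 stand for
the outputs 1 and 0, so a nonzero output appears, from position `k` on, exactly when `q 0 ∈ S`. -/
theorem eval_delayedProgram (S : Set ℕ) (k : ℕ) (q : Baire) :
    ∃ r ∈ Baire.eval (delayedProgram S k) q, (q 0 ∈ S ↔ ∃ n, r n ≠ 0) := by
  have hval : ∀ n j, 0 < j → (delayedProgram S k (Baire.code n (q.pre j)) = 2 ↔ q 0 ∈ S ∧ k ≤ n) ∧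
      delayedProgram S k (Baire.code n (q.pre j)) ≠ 0 ∧
      delayedProgram S k (Baire.code n (q.pre j)) ≤ 2 := by
    intro n j hj
    rw [delayedProgram_code, Baire.pre_length, Baire.pre_getD q hj, if_neg hj.ne']
    split_ifs with h
    · exact ⟨iff_of_true rfl h, by norm_num, le_rfl⟩
    · exact ⟨iff_of_false (by norm_num) h, by norm_num, by norm_num⟩
  have hpos : ∀ n (h : ∃ j, delayedProgram S k (Baire.code n (q.pre j)) ≠ 0), 0 < Nat.find h := by
    intro n h
    rw [Nat.find_pos]
    simp [delayedProgram_code, Baire.pre_length]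
  refine ⟨_, ⟨fun n => ⟨1, (hval n 1 one_pos).2.1⟩, rfl⟩, ?_⟩
  constructor
  · intro h
    refine ⟨k, ?_⟩
    change delayedProgram S k (Baire.code k (q.pre (Nat.find _))) - 1 ≠ 0
    rw [(hval k _ (hpos k ⟨1, (hval k 1 one_pos).2.1⟩)).1.2 ⟨h, le_rfl⟩]
    norm_num
  · rintro ⟨n, hn⟩
    change delayedProgram S k (Baire.code n (q.pre (Nat.find _))) - 1 ≠ 0 at hn
    have := hval n _ (hpos n ⟨1, (hval n 1 one_pos).2.1⟩)
    exact (this.1.1 (by omega)).1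

/-- At a fixed code, the delay eventually exceeds the output position, so `S` no longer influences
the answer. -/
theorem tendsto_delayedProgram (S : Set ℕ) :
    Filter.Tendsto (delayedProgram S) Filter.atTop (nhds (delayedProgram ∅ 0)) := by
  rw [Baire.tendsto_iff_forall_eventually_eq]
  intro a
  cases hd : (Encodable.decode a : Option (ℕ × List ℕ)) with
  | none => exact Filter.Eventually.of_forall fun k => by simp only [delayedProgram, hd]
  | some b =>
    filter_upwards [Filter.eventually_gt_atTop b.1] with k hk
    simp only [delayedProgram, hd, hk.not_ge, and_false, if_false, Set.mem_empty_iff_false,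
      false_and]

theorem negSpace_names_delayedProgram {m : ℕ} (S : Set ℕ) (k : ℕ)
    (A : TopologicalSpace.Closeds (finSpace m))
    (hA : ∀ i : Fin m, i ∈ (A : Set (finSpace m)) ↔ (i : ℕ) ∉ S) :
    (finSpace m).negSpace.names (delayedProgram S k) A := by
  intro q i hq
  obtain ⟨r, hr, h⟩ := eval_delayedProgram S k q
  refine ⟨r, hr, ?_⟩
  change ¬ (i ∈ (A : Set (finSpace m))) ↔ ∃ n, r n ≠ 0
  have hqS : q 0 ∈ S ↔ i ∉ (A : Set (finSpace m)) := by
    rw [show q 0 = Fin.val (n := m) i from hq]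
    exact (not_iff_comm.1 (hA i).symm).symm
  rw [← h, hqS]

theorem isOpen_finSpace {m : ℕ} (S : Set (finSpace m)) : IsOpen S := by
  rw [isOpen_coinduced]
  have hS : (finSpace m).δ ⁻¹' S =
      (fun p : (finSpace m).dom => p.1 0) ⁻¹' {n | ∃ i : Fin m, S i ∧ n = i} := by
    ext p
    have hp : p.1 0 = ((show Fin m from (finSpace m).δ p) : ℕ) := (finSpace m).names_δ p
    constructor
    · exact fun h => ⟨(finSpace m).δ p, h, hp⟩
    · rintro ⟨i, hi, hpi⟩
      have : (finSpace m).δ p = i := (finSpace m).functional ((finSpace m).names_δ p) hpi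
      exact Set.mem_preimage.2 (this.symm ▸ hi)
  rw [hS]
  exact (isOpen_discrete _).preimage
    ((continuous_apply (A := fun _ : ℕ => ℕ) 0).comp continuous_subtype_val)

end RepSpace

/-! ### The instances for `ACC` and `LLPO` -/

theorem not_weihrauchLE_ACC_VC {X : RepSpace.{u}} (hadm : X.Admissible)
    (hFU : FrechetUrysohnSpace X) {m : ℕ} (hm : 2 ≤ m) : ¬ WeihrauchLE (ACC m) (VC X) := by
  let z : Fin m → TopologicalSpace.Closeds (finSpace m) := fun i =>
    ⟨({i} : Set (Fin m))ᶜ, ⟨isOpen_finSpace _⟩⟩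
  have hnontriv : Nontrivial (Fin m) := Fin.nontrivial_iff_two_le.2 hm
  refine not_weihrauchLE_VC hadm hFU (f := ACC m) (p' := delayedProgram ∅ 0)
    (z' := (⊤ : TopologicalSpace.Closeds (finSpace m)))
    (p := fun i => delayedProgram {(i : ℕ)}) (z := fun i _ => z i)
    (negSpace_names_delayedProgram _ _ _ fun i => ?_) ?_ (fun i k => ?_) (fun i _ => ?_)
    (fun i => tendsto_delayedProgram _) fun i _ hi => ?_
  · exact iff_of_true trivial (Set.notMem_empty _)
  · exact ⟨(⟨0, by omega⟩ : Fin m), trivial, Or.inl rfl⟩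
  · exact negSpace_names_delayedProgram _ _ _ fun j => by
      change ¬ (j = i) ↔ ¬ ((j : ℕ) = i)
      rw [Fin.ext_iff]
  · obtain ⟨j, hj⟩ := exists_ne i
    exact ⟨j, hj, Or.inr ⟨i, rfl⟩⟩
  · exact hi.1 rfl

theorem not_weihrauchLE_LLPO_VC {X : RepSpace.{u}} (hadm : X.Admissible)
    (hFU : FrechetUrysohnSpace X) : ¬ WeihrauchLE LLPO (VC X) := by
  -- The single nonzero entry, at `2 * k + i`, refutes only the answer `i` and moves off to infinity
  -- with `k`.
  let p : Fin 2 → ℕ → Baire := fun i k => Pi.single (2 * k + i) 1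
  have hp : ∀ i k n, p i k n ≠ 0 ↔ n = 2 * k + i := fun i k n => by
    simp [p, Pi.single_apply]
  refine not_weihrauchLE_VC hadm hFU (f := LLPO) (p' := 0) (z' := (0 : Baire)) (p := p) (z := p)
    rfl ⟨(0 : Fin 2), fun k l h => absurd rfl h, fun _ => rfl⟩ (fun _ _ => rfl) (fun i k => ?_)
    (fun i => ?_) fun i k hi => ?_
  · obtain ⟨j, hj⟩ := exists_ne i
    refine ⟨j, fun a b ha hb => ?_, fun n => ?_⟩
    · rw [(hp i k a).1 ha, (hp i k b).1 hb]
    · by_contra hne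
      have := (hp i k _).1 hne
      exact hj (Fin.ext (by omega))
  · rw [Baire.tendsto_iff_forall_eventually_eq]
    intro n
    filter_upwards [Filter.eventually_gt_atTop n] with k hk
    by_contra hne
    have := (hp i k n).1 hne
    omega
  · exact (hp i k _).2 rfl (hi.2 k)

theorem mainTheorem8 (X : RepSpace.{u}) (hadm : X.Admissible) (hFU : FrechetUrysohnSpace X) :
    (∀ m : ℕ, 2 ≤ m → ¬ WeihrauchLE (ACC m) (VC X)) ∧ ¬ WeihrauchLE LLPO (VC X) :=
  ⟨fun _ hm => not_weihrauchLE_ACC_VC hadm hFU hm, not_weihrauchLE_LLPO_VC hadm hFU⟩
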